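/- Let $\mathsf A>0$, $1<\gamma<2$, $\mathsf{G}M_0>0$, $R_0>0$, $R>R_0$ and $\Omega\in\mathbb R$ be constants with $\frac{\Omega^2R^3}{2\mathsf GM_0}<\frac{4}{27}$. For $x\in\mathbb R^3$ put $r=|x|$, $\varpi=\sqrt{(x^1)^2+(x^2)^2}$, and for $r>R_0$ put $$\bar\Upsilon(x)=\mathsf GM_0\Big(\frac1r-\frac1R\Big)+\frac{\Omega^2}{2}\varpi^2 .$$ Let $\mathfrak R=\{x\in\mathbb R^3 : r>R_0,\ \varpi<\tfrac{3R}{2},\ \bar\Upsilon(x)>0\}$, an open set, and on $\mathfrak R$ let $$\bar\rho=\Big(\frac{\gamma-1}{\mathsf A\gamma}\bar\Upsilon\Big)^{\frac1{\gamma-1}},\qquad \overline{\frac{d\Upsilon}{d\rho}}=\mathsf A\gamma\,\bar\rho^{\,\gamma-2},$$ the latter being the derivative of $\Upsilon=\frac{\mathsf A\gamma}{\gamma-1}\rho^{\gamma-1}$ at $\rho=\bar\rho$. Let $\mathfrak H=L^2(\mathfrak R,\bar\rho\,dx;\mathbb C^3)$ and $$\mathbf L\xi=\nabla\Big(-\overline{\frac{d\Upsilon}{d\rho}}\,\nabla\cdot(\bar\rho\,\xi)\Big).$$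 Let $\mathfrak H^{\mathrm{div}}$ be the space of all $\xi\in\mathfrak H$ whose distributional divergence $\nabla\cdot(\bar\rho\xi)$ belongs to $L^2(\mathfrak R,\overline{\frac{d\Upsilon}{d\rho}}dx;\mathbb C)$, with the norm given by $$\|\xi\|_{\mathfrak H^{\mathrm{div}}}^2=\|\xi\|_{\mathfrak H}^2+\int_{\mathfrak R}\overline{\frac{d\Upsilon}{d\rho}}\,|\nabla\cdot(\bar\rho\xi)|^2dx,$$ and let $\mathfrak H_0^{\mathrm{div}}$ be the closure of $C_0^\infty(\mathfrak R;\mathbb C^3)$ in $\mathfrak H^{\mathrm{div}}$. Then the operator $\xi\mapsto\mathbf L\xi$ in $\mathfrak H$ with domain $C_0^\infty(\mathfrak R;\mathbb C^3)$ is densely defined, symmetric and semibounded, and it has a Friedrichs extension (the operator associated with the closure of the form $(\xi_1,\xi_2)\mapsto(\mathbf L\xi_1|\xi_2)_{\mathfrak H}$). The Friedrichs extension extends the operator, is self-adjoint and bounded from below by $0$ in $\mathfrak H$, its domain is $$\{\xi\in\mathfrak H_0^{\mathrm{div}} : \mathbf L\xi\in\mathfrak H \text{ in the sense of distributions}\},$$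 and on this domain it acts as the distributional operator $\mathbf L$. -/

import Mathlib

open MeasureTheory Set Filter Topology TopologicalSpace
open scoped ContDiff Distributions

noncomputable section

/-! ## The Friedrichs extension of a semibounded symmetric operator -/

namespace FriedrichsExt

variable {H : Type*} [NormedAddCommGroup H] [InnerProductSpace ℂ H]

/-- The sesquilinear form `t[u, v] = (T u | v)` of an operator `T`, for `u`, `v` in its domain.
The inner product of Mathlib is linear in its second argument. -/
def form (T : H →ₗ.[ℂ] H) (u v : T.domain) : ℂ := inner ℂ (v : H) (T u)

/-- `φ n` is `t`-convergent to `u`: it tends to `u` in `H` and `t[φ n - φ m] → 0`. -/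
def FormConverges (T : H →ₗ.[ℂ] H) (φ : ℕ → T.domain) (u : H) : Prop :=
  Tendsto (fun n => (φ n : H)) atTop (𝓝 u) ∧
    Tendsto (fun p : ℕ × ℕ => form T (φ p.1 - φ p.2) (φ p.1 - φ p.2)) atTop (𝓝 0)

/-- The domain of the closure of the form `t`. -/
def closedFormDomain (T : H →ₗ.[ℂ] H) : Set H := {u | ∃ φ, FormConverges T φ u}

/-- The closure of the form `t` has the value `c` at `(u, v)`. -/
def IsClosedFormValue (T : H →ₗ.[ℂ] H) (u v : H) (c : ℂ) : Prop :=
  ∀ φ ψ : ℕ → T.domain, FormConverges T φ u → FormConverges T ψ v →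
    Tendsto (fun n => form T (φ n) (ψ n)) atTop (𝓝 c)

/-- `F` is the Friedrichs extension of `T`: `T` is densely defined, symmetric and semibounded, and
`F` is the operator associated with the closure `t̄` of the form `t` of `T`, that is, `F u = f` if
and only if `u` lies in the domain of `t̄` and `t̄[u, v] = (f | v)` for all `v` in that domain. -/
structure IsFriedrichsExtension (T F : H →ₗ.[ℂ] H) : Prop where
  dense : Dense (T.domain : Set H)
  symmetric : T.IsFormalAdjoint T
  semibounded : ∃ c : ℝ, ∀ u : T.domain, c * ‖(u : H)‖ ^ 2 ≤ (form T u u).re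
  graph : ∀ u f : H, (u, f) ∈ F.graph ↔
    u ∈ closedFormDomain T ∧ ∀ v ∈ closedFormDomain T, IsClosedFormValue T u v (inner ℂ v f)

end FriedrichsExt

/-! ## Test functions, distributions and weighted spaces on an open subset of `ℝ³` -/

/-- The space `ℝ³`. -/
abbrev R3 : Type := EuclideanSpace ℝ (Fin 3)

/-- The space `ℂ³`. -/
abbrev C3 : Type := EuclideanSpace ℂ (Fin 3)

namespace OpenR3

/-- The standard basis vector `e k` of `ℝ³`. -/
abbrev basisVec (k : Fin 3) : R3 := EuclideanSpace.single k 1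

variable {Ω : Opens R3} {F : Type*} [NormedAddCommGroup F] [NormedSpace ℝ F] [NormedSpace ℂ F]
  [IsScalarTower ℝ ℂ F]

/-- The partial derivative `∂ₖ` on test functions. -/
def partialDeriv (k : Fin 3) : 𝓓(Ω, ℂ) →ₗ[ℂ] 𝓓(Ω, ℂ) :=
  (TestFunction.lineDerivCLM ℂ (basisVec k)).toLinearMap

/-- The `k`-th component of a test field. -/
def component (k : Fin 3) : 𝓓(Ω, C3) →ₗ[ℂ] 𝓓(Ω, ℂ) :=
  (TestFunction.postcompCLM (𝕜 := ℂ) (EuclideanSpace.proj k)).toLinearMap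

/-- The test field `u e k`. -/
def alongBasis (k : Fin 3) : 𝓓(Ω, ℂ) →ₗ[ℂ] 𝓓(Ω, C3) :=
  (TestFunction.postcompCLM (𝕜 := ℂ)
    ((ContinuousLinearMap.id ℂ ℂ).smulRight (EuclideanSpace.single k (1 : ℂ) : C3))).toLinearMap

/-- The divergence of a test field. -/
def testDiv : 𝓓(Ω, C3) →ₗ[ℂ] 𝓓(Ω, ℂ) := ∑ k, partialDeriv k ∘ₗ component k

/-- The gradient of a test function. -/
def testGrad : 𝓓(Ω, ℂ) →ₗ[ℂ] 𝓓(Ω, C3) := ∑ k, alongBasis k ∘ₗ partialDeriv k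

/-- Multiplication of test functions on `Ω` by a real function that is smooth on `Ω`. -/
def mulSmooth (a : R3 → ℝ) (ha : ContDiffOn ℝ ∞ a Ω) : 𝓓(Ω, F) →ₗ[ℂ] 𝓓(Ω, F) where
  toFun φ :=
    { toFun := fun x => a x • φ x
      contDiff' := by
        rw [contDiff_iff_contDiffAt]
        intro x
        by_cases hx : x ∈ tsupport φ
        · exact (ha.contDiffAt (Ω.isOpen.mem_nhds (φ.tsupport_subset hx))).smul
            φ.contDiff.contDiffAt
        · have h0 : (fun y => a y • φ y) =ᶠ[𝓝 x] fun _ => (0 : F) := by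
            filter_upwards [notMem_tsupport_iff_eventuallyEq.mp hx] with y hy
            simp [hy]
          exact contDiffAt_const.congr_of_eventuallyEq h0
      hasCompactSupport' := φ.hasCompactSupport.smul_left
      tsupport_subset' := (closure_mono (Function.support_smul_subset_right _ _)).trans
        φ.tsupport_subset }
  map_add' φ ψ := by
    ext x
    exact smul_add _ _ _
  map_smul' c φ := by
    ext x
    exact smul_comm _ _ _

/-- Distributions on `Ω`, as linear functionals on `C_0^∞(Ω; ℂ)`. Only distributions obtained from
locally integrable functions by the operations below are used; they are continuous. -/
abbrev Distr (Ω : Opens R3) : Type := 𝓓(Ω, ℂ) →ₗ[ℂ] ℂ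

/-- The distribution `φ ↦ ∫ φ u dx` given by a locally integrable function `u` on `Ω`. -/
def distrOf (u : R3 → ℂ) : Distr Ω :=
  (TestFunction.integralAgainstBilinCLM (ContinuousLinearMap.mul ℂ ℂ) volume u).toLinearMap

/-- The distributional partial derivative `(∂ₖ T)(φ) = -T(∂ₖ φ)`. -/
def distrDeriv (k : Fin 3) (T : Distr Ω) : Distr Ω := -(T ∘ₗ partialDeriv k)

/-- The product `(a T)(φ) = T(a φ)` of a distribution with a smooth function. -/
def distrMul (a : R3 → ℝ) (ha : ContDiffOn ℝ ∞ a Ω) (T : Distr Ω) : Distr Ω :=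
  T ∘ₗ mulSmooth a ha

/-- The distributional divergence of a locally integrable vector field. -/
def distrDiv (v : R3 → C3) : Distr Ω := ∑ k, distrDeriv k (distrOf fun x => v x k)

/-- The measure `w dx` on `Ω`. -/
def weighted (Ω : Opens R3) (w : R3 → ℝ) : Measure R3 :=
  (volume.restrict (Ω : Set R3)).withDensity fun x => ENNReal.ofReal (w x)

end OpenR3

namespace OpenR3

variable {Ω : Opens R3} {F : Type*} [NormedAddCommGroup F] [NormedSpace ℝ F]

lemma memLp_weighted {w : R3 → ℝ} (hw : ContinuousOn w Ω) (φ : 𝓓(Ω, F)) :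
    MemLp φ 2 (weighted Ω w) := by
  have hK : IsCompact (tsupport φ) := φ.hasCompactSupport
  have hKm : MeasurableSet (tsupport φ) := (isClosed_tsupport _).measurableSet
  obtain ⟨C, hC⟩ := hK.exists_bound_of_continuousOn (hw.mono φ.tsupport_subset)
  obtain ⟨D, hD⟩ := hK.exists_bound_of_continuousOn φ.continuous.continuousOn
  have hfin : weighted Ω w (tsupport φ) < ⊤ := by
    rw [weighted, withDensity_apply _ hKm]
    calc ∫⁻ x in tsupport φ, ENNReal.ofReal (w x) ∂(volume.restrict (Ω : Set R3))
        ≤ ∫⁻ _ in tsupport φ, ENNReal.ofReal C ∂(volume.restrict (Ω : Set R3)) :=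
          setLIntegral_mono' hKm fun x hx =>
            ENNReal.ofReal_le_ofReal ((le_abs_self _).trans (hC x hx))
      _ ≤ ∫⁻ _ in tsupport φ, ENNReal.ofReal C :=
          lintegral_mono' (Measure.restrict_mono' (Eventually.of_forall fun _ h => h)
            Measure.restrict_le_self) le_rfl
      _ < ⊤ := by
          rw [setLIntegral_const]
          exact ENNReal.mul_lt_top ENNReal.ofReal_lt_top hK.measure_lt_top
  have : IsFiniteMeasure ((weighted Ω w).restrict (tsupport φ)) :=
    ⟨by rwa [Measure.restrict_apply_univ]⟩
  have hind : (tsupport φ).indicator φ = φ := indicator_eq_self.mpr (subset_tsupport φ)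
  rw [← hind, memLp_indicator_iff_restrict hKm]
  refine MemLp.of_bound φ.aestronglyMeasurable D ?_
  exact (ae_restrict_iff' hKm).mpr (Eventually.of_forall hD)

variable [NormedSpace ℂ F] [IsScalarTower ℝ ℂ F]

/-- The inclusion of the test functions on `Ω` in `L²(Ω, w dx; F)`. -/
def testToL2 (w : R3 → ℝ) (hw : ContinuousOn w Ω) : 𝓓(Ω, F) →ₗ[ℂ] Lp F 2 (weighted Ω w) where
  toFun φ := (memLp_weighted hw φ).toLp φ
  map_add' _ _ := rfl
  map_smul' _ _ := rfl

lemma testToL2_injective {w : R3 → ℝ} (hw : ContinuousOn w Ω) (hpos : ∀ x ∈ Ω, 0 < w x) :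
    Function.Injective (testToL2 (F := F) w hw) := by
  intro φ ψ h
  have h1 : φ =ᵐ[weighted Ω w] ψ := 
    (MemLp.toLp_eq_toLp_iff (memLp_weighted hw φ) (memLp_weighted hw ψ)).mp h
  have hwm : AEMeasurable (fun x => ENNReal.ofReal (w x)) (volume.restrict (Ω : Set R3)) :=
    (hw.aemeasurable Ω.isOpen.measurableSet).ennreal_ofReal
  have h2 : φ =ᵐ[volume.restrict (Ω : Set R3)] ψ := by
    have h3 := (ae_withDensity_iff' hwm).mp h1
    filter_upwards [h3, ae_restrict_mem Ω.isOpen.measurableSet] with x hx hxΩ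
    exact hx (ENNReal.ofReal_pos.mpr (hpos x hxΩ)).ne'
  have h4 : EqOn φ ψ Ω := Measure.eqOn_open_of_ae_eq h2 Ω.isOpen φ.continuous.continuousOn
    ψ.continuous.continuousOn
  ext x
  by_cases hx : x ∈ Ω
  · exact h4 hx
  · rw [image_eq_zero_of_notMem_tsupport fun hx' => hx (φ.tsupport_subset hx'),
      image_eq_zero_of_notMem_tsupport fun hx' => hx (ψ.tsupport_subset hx')]

end OpenR3

/-! ## The atmosphere in static equilibrium -/

/-- The physical constants: the constants `A`, `γ` of the equation of state `P = A ρ ^ γ`, the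
product `GM` of the gravitational constant and the mass of the Earth, the radius `R0` of the
Earth, the radius `R` of the stratosphere at the poles, and the angular velocity `Ω`. -/
structure Atmosphere where
  A : ℝ
  γ : ℝ
  GM : ℝ
  R0 : ℝ
  R : ℝ
  Ω : ℝ
  A_pos : 0 < A
  one_lt_γ : 1 < γ
  γ_lt_two : γ < 2
  GM_pos : 0 < GM
  R0_pos : 0 < R0
  R0_lt_R : R0 < R
  rotation_small : Ω ^ 2 * R ^ 3 / (2 * GM) < 4 / 27

namespace Atmosphere

open OpenR3

variable (a : Atmosphere)

/-- The distance to the axis of rotation. -/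
def axisDist (x : R3) : ℝ := √(x 0 ^ 2 + x 1 ^ 2)

/-- The geopotential; only its values at `‖x‖ > R0` are used. -/
def geopotential (x : R3) : ℝ := -a.GM / ‖x‖ - a.Ω ^ 2 / 2 * axisDist x ^ 2

/-- The enthalpy variable `ϒ` of the equilibrium. -/
def enthalpy (x : R3) : ℝ := -a.geopotential x - a.GM / a.R

/-- The set of the points outside the Earth where the equilibrium density is positive. -/
def regionSet : Set R3 := {x | 0 < a.enthalpy x ∧ axisDist x < 3 * a.R / 2 ∧ a.R0 < ‖x‖}

/-- The density of the equilibrium. -/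
def density (x : R3) : ℝ :=
  ((a.γ - 1) / (a.A * a.γ) * (if axisDist x < 3 * a.R / 2 then max (a.enthalpy x) 0 else 0))
    ^ (1 / (a.γ - 1))

/-- `ϒ` as a function of the density: `ϒ = A γ / (γ - 1) ρ ^ (γ - 1)`. -/
def enthalpyOfDensity (ρ : ℝ) : ℝ := a.A * a.γ / (a.γ - 1) * ρ ^ (a.γ - 1)

/-- The function `dϒ/dρ` at the equilibrium. -/
def stiffness (x : R3) : ℝ := deriv a.enthalpyOfDensity (a.density x)

lemma enthalpyOfDensity_deriv {ρ : ℝ} (hρ : 0 < ρ) :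
    deriv a.enthalpyOfDensity ρ = a.A * a.γ * ρ ^ (a.γ - 2) := by
  have h := ((Real.hasDerivAt_rpow_const (p := a.γ - 1) (Or.inl hρ.ne')).const_mul
    (a.A * a.γ / (a.γ - 1))).deriv
  have h1 : a.γ - 1 ≠ 0 := (sub_pos.mpr a.one_lt_γ).ne'
  unfold enthalpyOfDensity
  rw [h, show a.γ - 1 - 1 = a.γ - 2 by ring]
  field_simp

lemma contDiffAt_enthalpy {x : R3} (hx : a.R0 < ‖x‖) : ContDiffAt ℝ ∞ a.enthalpy x := by
  have hx0 : x ≠ 0 := norm_pos_iff.mp (a.R0_pos.trans hx)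
  have hc : ∀ k : Fin 3, ContDiffAt ℝ ∞ (fun y : R3 => y k) x := fun k =>
    (EuclideanSpace.proj (𝕜 := ℝ) k : R3 →L[ℝ] ℝ).contDiff.contDiffAt
  have h : a.enthalpy = fun y : R3 =>
      -(-a.GM / ‖y‖ - a.Ω ^ 2 / 2 * (y 0 ^ 2 + y 1 ^ 2)) - a.GM / a.R := by
    funext y
    simp only [enthalpy, geopotential, axisDist]
    rw [Real.sq_sqrt (by positivity)]
  rw [h]
  exact ((contDiffAt_const.div (contDiffAt_norm ℝ hx0) (norm_ne_zero_iff.mpr hx0)).sub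
    (contDiffAt_const.mul (((hc 0).pow 2).add ((hc 1).pow 2)))).neg.sub contDiffAt_const

lemma continuous_axisDist : Continuous axisDist := by
  unfold axisDist
  fun_prop

/-- The domain occupied by the atmosphere. -/
def region : Opens R3 where
  carrier := a.regionSet
  is_open' := by
    rw [isOpen_iff_mem_nhds]
    rintro x ⟨h1, h2, h3⟩
    filter_upwards [(a.contDiffAt_enthalpy h3).continuousAt.eventually (lt_mem_nhds h1),
      continuous_axisDist.continuousAt.eventually (gt_mem_nhds h2),
      continuous_norm.continuousAt.eventually (lt_mem_nhds h3)] with y k1 k2 k3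
    exact ⟨k1, k2, k3⟩

lemma density_eq {x : R3} (hx : x ∈ a.region) :
    a.density x = ((a.γ - 1) / (a.A * a.γ) * a.enthalpy x) ^ (1 / (a.γ - 1)) := by
  rw [density, if_pos hx.2.1, max_eq_left hx.1.le]

lemma density_base_pos {x : R3} (hx : x ∈ a.region) :
    0 < (a.γ - 1) / (a.A * a.γ) * a.enthalpy x :=
  mul_pos (div_pos (sub_pos.mpr a.one_lt_γ)
    (mul_pos a.A_pos (one_pos.trans a.one_lt_γ))) hx.1

lemma density_pos {x : R3} (hx : x ∈ a.region) : 0 < a.density x := by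
  rw [a.density_eq hx]
  exact Real.rpow_pos_of_pos (a.density_base_pos hx) _

lemma stiffness_eq {x : R3} (hx : x ∈ a.region) :
    a.stiffness x = a.A * a.γ * a.density x ^ (a.γ - 2) :=
  a.enthalpyOfDensity_deriv (a.density_pos hx)

lemma density_smooth : ContDiffOn ℝ ∞ a.density a.region := by
  have h : ContDiffOn ℝ ∞
      (fun x => ((a.γ - 1) / (a.A * a.γ) * a.enthalpy x) ^ (1 / (a.γ - 1))) a.region :=
    fun x hx => ((contDiffAt_const.mul (a.contDiffAt_enthalpy hx.2.2)).rpow_const_of_ne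
      (a.density_base_pos hx).ne').contDiffWithinAt
  exact h.congr fun x hx => a.density_eq hx

lemma stiffness_smooth : ContDiffOn ℝ ∞ a.stiffness a.region := by
  have h : ContDiffOn ℝ ∞ (fun x => a.A * a.γ * a.density x ^ (a.γ - 2)) a.region :=
    fun x hx => contDiffWithinAt_const.mul
      ((a.density_smooth x hx).rpow_const_of_ne (a.density_pos hx).ne')
  exact h.congr fun x hx => a.stiffness_eq hx

/-- The Hilbert space `L²(region, ρ dx; ℂ³)`. -/
abbrev H : Type := Lp C3 2 (weighted a.region a.density)

/-- The Hilbert space `L²(region, (dϒ/dρ) dx; ℂ)`. -/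
abbrev K : Type := Lp ℂ 2 (weighted a.region a.stiffness)

/-- The inclusion of `C_0^∞(region; ℂ³)` in `H`. -/
def testToH : 𝓓(a.region, C3) →ₗ[ℂ] a.H := testToL2 a.density a.density_smooth.continuousOn

/-- The inclusion of `C_0^∞(region; ℂ)` in `K`. -/
def testToK : 𝓓(a.region, ℂ) →ₗ[ℂ] a.K := testToL2 a.stiffness a.stiffness_smooth.continuousOn

lemma testToH_injective : Function.Injective a.testToH :=
  testToL2_injective _ fun _ hx => a.density_pos hx

/-- `g = ∇·(ρ φ)` for a test field `φ`. -/
def testG : 𝓓(a.region, C3) →ₗ[ℂ] 𝓓(a.region, ℂ) :=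
  testDiv ∘ₗ mulSmooth a.density a.density_smooth

/-- `L φ = ∇(-(dϒ/dρ) ∇·(ρ φ))` for a test field `φ`. -/
def testL : 𝓓(a.region, C3) →ₗ[ℂ] 𝓓(a.region, C3) :=
  testGrad ∘ₗ (-mulSmooth a.stiffness a.stiffness_smooth) ∘ₗ a.testG

/-- The operator `φ ↦ L φ` in `H` with the domain `C_0^∞(region; ℂ³)`. -/
def minimalL : a.H →ₗ.[ℂ] a.H where
  domain := LinearMap.range a.testToH
  toFun := a.testToH ∘ₗ a.testL ∘ₗ
    (LinearEquiv.ofInjective a.testToH a.testToH_injective).symm.toLinearMap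

lemma minimalL_apply (φ : 𝓓(a.region, C3)) :
    a.minimalL ⟨a.testToH φ, φ, rfl⟩ = a.testToH (a.testL φ) := by
  have h : (LinearEquiv.ofInjective a.testToH a.testToH_injective).symm
      ⟨a.testToH φ, φ, rfl⟩ = φ := by
    rw [LinearEquiv.symm_apply_eq]
    rfl
  change a.testToH (a.testL ((LinearEquiv.ofInjective a.testToH a.testToH_injective).symm
      ⟨a.testToH φ, φ, rfl⟩)) = _
  rw [h]

/-- The distribution `∇·(ρ ξ)`. -/
def distrG (ξ : a.H) : Distr a.region := distrDiv fun x => a.density x • ξ x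

/-- The `j`-th component of the distribution `L ξ = ∇(-(dϒ/dρ) ∇·(ρ ξ))`. -/
def distrL (ξ : a.H) (j : Fin 3) : Distr a.region :=
  distrDeriv j (-distrMul a.stiffness a.stiffness_smooth (a.distrG ξ))

/-- `L ξ = f` in the sense of distributions. -/
def IsDistrL (ξ f : a.H) : Prop := ∀ j, a.distrL ξ j = distrOf fun x => f x j

/-- `ξ ∈ H^div`, with `g = ∇·(ρ ξ) ∈ K` in the sense of distributions. -/
def IsHdiv (ξ : a.H) (g : a.K) : Prop := a.distrG ξ = distrOf g

/-- `H^div_0`, the closure of `C_0^∞(region; ℂ³)` in `H^div` for the norm given by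
`‖ξ‖² = ‖ξ‖²_H + ‖∇·(ρ ξ)‖²_K`. -/
def HdivZero : Set a.H :=
  {ξ | ∃ g : a.K, a.IsHdiv ξ g ∧ ∀ ε > 0, ∃ φ : 𝓓(a.region, C3),
    ‖ξ - a.testToH φ‖ ^ 2 + ‖g - a.testToK (a.testG φ)‖ ^ 2 < ε}

end Atmosphere

end

noncomputable section

/-! ## The operator associated with the closure of a nonnegative form -/

/-! Integration by parts factors the form of `L`: `(L φ | ψ)_H = (∇·(ρ φ) | ∇·(ρ ψ))_K` for test
fields (`form_minimalL`). Hence everything reduces to a pair of linear maps on the test fields, the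
dense inclusion `i` in `H` and `g φ = ∇·(ρ φ)` in `K`, and to the closure of the set of pairs `(i φ,
g φ)` in `H × K`.

The form is closable when that closure is again the graph of a map, which holds because the
distributional divergence is continuous for convergence in `H` (`eq_zero_of_mem_closedGraph`). The
operator `A` of the closed form sends `u` to `f` when `(u, k)` is in the closure and `(g φ | k) = (i
φ | f)` for all `φ`. It is symmetric and nonnegative, and projecting `(f, 0)` orthogonally onto the
closed graph solves `u + A u = f` (`exists_mem_associatedGraph`); symmetry and surjectivity of `1 +
A` give self-adjointness. Completeness of `K` identifies `A` with the Friedrichs extension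
(`isFriedrichsExtension_associated`).

The domain is then read off: the first components of the closed graph form `H^div_0`
(`mem_HdivZero`), and the weak equation tested on all fields is `L u = f` in the sense of
distributions (`isDistrL_iff`). The analysis rests on the two weights being smooth and positive in
the region. -/

/-- A densely defined symmetric operator `T` for which `1 + T` is onto is self-adjoint. -/
theorem LinearPMap.isSelfAdjoint_of_surjective_one_add {H : Type*} [NormedAddCommGroup H]
    [InnerProductSpace ℂ H] [CompleteSpace H] {T : H →ₗ.[ℂ] H} (hd : Dense (T.domain : Set H))
    (hs : T.IsFormalAdjoint T) (hr : ∀ f : H, ∃ x : T.domain, (x : H) + T x = f) :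
    IsSelfAdjoint T := by
  rw [LinearPMap.isSelfAdjoint_def]
  refine le_antisymm ?_ (hs.le_adjoint hd)
  have key : ∀ y : T.adjoint.domain, ∃ x : T.domain, (x : H) = y ∧ T x = T.adjoint y := by
    intro y
    obtain ⟨x, hx⟩ := hr (y + T.adjoint y)
    -- By symmetry and the choice of `x`, the vector `y - x` is orthogonal to the range of `1 + T`.
    -- It lies in that range, so it is orthogonal to itself.
    have h0 : (y : H) - x = 0 := by
      obtain ⟨z, hz⟩ := hr ((y : H) - x)
      have h1 := LinearPMap.adjoint_isFormalAdjoint hd y z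
      have h2 := hs x z
      have h3 : inner ℂ ((y : H) - x) ((z : H) + T z) = 0 := by
        rw [inner_add_right, inner_sub_left, inner_sub_left, ← h1, ← h2]
        have h4 : inner ℂ ((y : H) + T.adjoint y) (z : H) = inner ℂ ((x : H) + T x) (z : H) := by
          rw [hx]
        rw [inner_add_left, inner_add_left] at h4
        linear_combination h4
      rw [hz] at h3
      exact inner_self_eq_zero.mp h3
    have hxy : (x : H) = y := (sub_eq_zero.mp h0).symm
    exact ⟨x, hxy, by rw [hxy] at hx; exact add_left_cancel hx⟩
  refine LinearPMap.le_of_le_graph ?_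
  rintro ⟨u, f⟩ huf
  obtain ⟨y, hy, hy'⟩ := (LinearPMap.mem_graph_iff _).mp huf
  obtain ⟨x, hx, hx'⟩ := key y
  exact (LinearPMap.mem_graph_iff _).mpr ⟨x, hx.trans hy, hx'.trans hy'⟩

namespace FriedrichsExt

variable {E H K : Type*} [AddCommGroup E] [Module ℂ E] [NormedAddCommGroup H]
  [InnerProductSpace ℂ H] [NormedAddCommGroup K] [InnerProductSpace ℂ K]

/-- The closure of the graph of the relation `i φ ↦ g φ`. -/
def closedGraph (i : E →ₗ[ℂ] H) (g : E →ₗ[ℂ] K) : Submodule ℂ (H × K) :=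
  (LinearMap.range (i.prod g)).topologicalClosure

/-- The graph of the operator associated with the closure of the form
`(i φ, i ψ) ↦ (g φ | g ψ)`. -/
def associatedGraph (i : E →ₗ[ℂ] H) (g : E →ₗ[ℂ] K) : Submodule ℂ (H × H) where
  carrier := {p | ∃ k, (p.1, k) ∈ closedGraph i g ∧ ∀ φ, inner ℂ (g φ) k = inner ℂ (i φ) p.2}
  zero_mem' := ⟨0, (closedGraph i g).zero_mem, fun φ => by simp⟩
  add_mem' := by
    rintro p q ⟨k, hk, hk'⟩ ⟨l, hl, hl'⟩
    exact ⟨k + l, (closedGraph i g).add_mem hk hl, fun φ => by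
      simp only [Prod.snd_add, inner_add_right, hk', hl']⟩
  smul_mem' := by
    rintro c p ⟨k, hk, hk'⟩
    exact ⟨c • k, (closedGraph i g).smul_mem c hk, fun φ => by
      simp only [Prod.smul_snd, inner_smul_right, hk']⟩

/-- The operator associated with the closure of the form `(i φ, i ψ) ↦ (g φ | g ψ)`. -/
def associated (i : E →ₗ[ℂ] H) (g : E →ₗ[ℂ] K) : H →ₗ.[ℂ] H := (associatedGraph i g).toLinearPMap

variable {i : E →ₗ[ℂ] H} {g : E →ₗ[ℂ] K}

lemma mem_associatedGraph {u f : H} : (u, f) ∈ associatedGraph i g ↔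
    ∃ k, (u, k) ∈ closedGraph i g ∧ ∀ φ, inner ℂ (g φ) k = inner ℂ (i φ) f := Iff.rfl

lemma mk_mem_closedGraph (φ : E) : (i φ, g φ) ∈ closedGraph i g :=
  Submodule.le_topologicalClosure _ ⟨φ, rfl⟩

lemma mem_closedGraph_iff_seq {p : H × K} : p ∈ closedGraph i g ↔
    ∃ e : ℕ → E, Tendsto (fun n => i (e n)) atTop (𝓝 p.1) ∧
      Tendsto (fun n => g (e n)) atTop (𝓝 p.2) := by
  rw [closedGraph, ← SetLike.mem_coe, Submodule.topologicalClosure_coe, mem_closure_iff_seq_limit]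
  constructor
  · rintro ⟨x, hx, hp⟩
    choose e he using hx
    refine ⟨e, ?_, ?_⟩
    · exact ((continuous_fst.tendsto p).comp hp).congr fun n => congrArg Prod.fst (he n).symm
    · exact ((continuous_snd.tendsto p).comp hp).congr fun n => congrArg Prod.snd (he n).symm
  · rintro ⟨e, h1, h2⟩
    exact ⟨fun n => (i (e n), g (e n)), fun n => ⟨e n, rfl⟩, h1.prodMk_nhds h2⟩

/-- Both sides are continuous in `v`, so an identity tested on `E` extends to the whole form domain.
Applied to elements of the operator domain it yields symmetry and nonnegativity. -/
lemma inner_eq_of_mem_closedGraph {u : H × K} {f : H}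
    (h : ∀ φ, inner ℂ (g φ) u.2 = inner ℂ (i φ) f) {v : H × K} (hv : v ∈ closedGraph i g) :
    inner ℂ v.2 u.2 = inner ℂ v.1 f := by
  obtain ⟨e, h1, h2⟩ := mem_closedGraph_iff_seq.mp hv
  refine tendsto_nhds_unique (h2.inner tendsto_const_nhds) ?_
  simp_rw [h]
  exact h1.inner tendsto_const_nhds

variable (hd : DenseRange i) (hc : ∀ k, (0, k) ∈ closedGraph i g → k = 0)

include hc in
lemma closedGraph_unique {u : H} {k l : K} (hk : (u, k) ∈ closedGraph i g)
    (hl : (u, l) ∈ closedGraph i g) : k = l := by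
  refine sub_eq_zero.mp (hc _ ?_)
  simpa using (closedGraph i g).sub_mem hk hl

include hd hc in
-- Only single-valuedness is at stake. Closability `hc` turns `u = 0` into `k = 0`, and then `f` is
-- orthogonal to the dense range of `i`.
lemma associated_graph : (associated i g).graph = associatedGraph i g := by
  refine Submodule.toLinearPMap_graph_eq _ ?_
  rintro ⟨u, f⟩ huf (rfl : u = 0)
  obtain ⟨k, hk, h⟩ := mem_associatedGraph.mp huf
  obtain rfl := hc k hk
  refine Dense.eq_zero_of_inner_right ℂ hd ?_
  rintro _ ⟨φ, rfl⟩
  simpa using (h φ).symm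

include hd hc in
lemma associated_spec (x : (associated i g).domain) :
    ∃ k, ((x : H), k) ∈ closedGraph i g ∧
      ∀ v ∈ closedGraph i g, inner ℂ v.2 k = inner ℂ v.1 (associated i g x) := by
  have hx := LinearPMap.mem_graph (associated i g) x
  rw [associated_graph hd hc] at hx
  obtain ⟨k, hk, h⟩ := mem_associatedGraph.mp hx
  exact ⟨k, hk, fun v hv => inner_eq_of_mem_closedGraph (u := ((x : H), k)) h hv⟩

include hd hc in
lemma associated_isFormalAdjoint : (associated i g).IsFormalAdjoint (associated i g) := by
  intro x y
  obtain ⟨k, hk, h⟩ := associated_spec hd hc x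
  obtain ⟨l, hl, h'⟩ := associated_spec hd hc y
  rw [← h' _ hk, ← inner_conj_symm, ← h _ hl, inner_conj_symm]

include hd hc in
lemma associated_nonneg (x : (associated i g).domain) :
    0 ≤ (inner ℂ (associated i g x) (x : H)).re := by
  obtain ⟨k, hk, h⟩ := associated_spec hd hc x
  rw [← inner_conj_symm, ← h _ hk, inner_conj_symm]
  exact inner_self_nonneg (𝕜 := ℂ)

/-- If `(u, k)` is the orthogonal projection of `(f, 0)` onto the closed graph, the residual `(f -
u, -k)` is orthogonal to every `(i φ, g φ)`. This is the weak form of `A u = f - u`. -/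
lemma exists_mem_associatedGraph [CompleteSpace H] [CompleteSpace K] (f : H) :
    ∃ u, (u, f - u) ∈ associatedGraph i g := by
  -- The norm of `H × K` is the maximum norm; the projection requires the Hilbert sum, which has the
  -- same topology.
  let W : Submodule ℂ (WithLp 2 (H × K)) :=
    (closedGraph i g).comap (WithLp.prodContinuousLinearEquiv 2 ℂ H K).toLinearMap
  have hW : IsClosed (W : Set (WithLp 2 (H × K))) :=
    (Submodule.isClosed_topologicalClosure _).preimage
      (WithLp.prodContinuousLinearEquiv 2 ℂ H K).continuous
  have : CompleteSpace W := hW.completeSpace_coe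
  let z : WithLp 2 (H × K) := WithLp.toLp 2 (f, 0)
  let w : WithLp 2 (H × K) := W.starProjection z
  have hw : w ∈ W := W.starProjection_apply_mem z
  refine ⟨w.fst, w.snd, hw, fun φ => ?_⟩
  have hφ : (WithLp.toLp 2 (i φ, g φ) : WithLp 2 (H × K)) ∈ W := mk_mem_closedGraph φ
  have h := W.sub_starProjection_mem_orthogonal z _ hφ
  change inner ℂ _ (z - w) = 0 at h
  simp only [WithLp.prod_inner_apply] at h
  simp only [z, WithLp.ofLp_sub, Prod.fst_sub, Prod.snd_sub, zero_sub, inner_neg_right] at h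
  exact (sub_eq_zero.mp h).symm

/-! ### Identification with the Friedrichs extension -/

variable {T : H →ₗ.[ℂ] H} (hT : T.domain = LinearMap.range i)
  (hf : ∀ (φ ψ : E) (u v : T.domain), (u : H) = i φ → (v : H) = i ψ →
    form T u v = inner ℂ (g ψ) (g φ))

include hd hc hT hf in
lemma le_associated : T ≤ associated i g := by
  refine LinearPMap.le_of_le_graph ?_
  rw [associated_graph hd hc]
  rintro ⟨u, f⟩ huf
  obtain ⟨x, rfl, rfl⟩ := (LinearPMap.mem_graph_iff _).mp huf
  have hx : (x : H) ∈ LinearMap.range i := hT ▸ x.2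
  obtain ⟨φ, hφ⟩ := hx
  refine ⟨g φ, ?_, fun ψ => ?_⟩
  · simpa [← hφ] using mk_mem_closedGraph (i := i) (g := g) φ
  · exact (hf φ ψ x ⟨i ψ, hT ▸ ⟨ψ, rfl⟩⟩ hφ.symm rfl).symm

include hd hc hT hf in
lemma associated_isSelfAdjoint [CompleteSpace H] [CompleteSpace K] :
    IsSelfAdjoint (associated i g) := by
  have hdom : Dense ((associated i g).domain : Set H) := by
    refine hd.mono ?_
    rintro _ ⟨φ, rfl⟩
    exact (le_associated hd hc hT hf).1 (hT ▸ ⟨φ, rfl⟩)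
  refine LinearPMap.isSelfAdjoint_of_surjective_one_add hdom (associated_isFormalAdjoint hd hc)
    fun f => ?_
  obtain ⟨u, hu⟩ := exists_mem_associatedGraph (i := i) (g := g) f
  rw [← associated_graph hd hc] at hu
  obtain ⟨x, hx, hx'⟩ := (LinearPMap.mem_graph_iff _).mp hu
  exact ⟨x, by rw [hx', hx]; simp⟩

include hf in
-- The form at a difference is `‖g (e n) - g (e m)‖ ^ 2`, so the second condition of form
-- convergence is the Cauchy property of `g (e n)` in `K`.
lemma formConverges_iff {e : ℕ → E} {φ : ℕ → T.domain} (he : ∀ n, (φ n : H) = i (e n)) (u : H) :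
    FormConverges T φ u ↔
      Tendsto (fun n => i (e n)) atTop (𝓝 u) ∧ CauchySeq fun n => g (e n) := by
  have h1 : ∀ n m, form T (φ n - φ m) (φ n - φ m) = ((‖g (e n) - g (e m)‖ ^ 2 : ℝ) : ℂ) := by
    intro n m
    rw [hf (e n - e m) (e n - e m) _ _ (by simp [he]) (by simp [he]), inner_self_eq_norm_sq_to_K,
      map_sub]
    push_cast
    rfl
  simp only [FormConverges, he, h1]
  refine and_congr_right fun _ => ?_
  rw [cauchySeq_iff_tendsto_dist_atTop_0]
  simp only [dist_eq_norm]
  have h2 : Tendsto (fun p : ℕ × ℕ => ((‖g (e p.1) - g (e p.2)‖ ^ 2 : ℝ) : ℂ)) atTop (𝓝 0) ↔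
      Tendsto (fun p : ℕ × ℕ => ‖g (e p.1) - g (e p.2)‖ ^ 2) atTop (𝓝 0) := by
    rw [← Complex.ofReal_zero]
    exact Complex.isometry_ofReal.isUniformInducing.isInducing.tendsto_nhds_iff.symm
  rw [h2]
  constructor
  · intro h
    simpa [Real.sqrt_sq] using h.sqrt
  · intro h
    simpa using h.pow 2

include hT hf in
lemma closedFormDomain_eq [CompleteSpace K] :
    closedFormDomain T = {u | ∃ k, (u, k) ∈ closedGraph i g} := by
  ext u
  constructor
  · rintro ⟨φ, hφ⟩
    have : ∀ n, ∃ e, i e = (φ n : H) := fun n => by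
      exact hT.le (φ n).2
    choose e he using this
    obtain ⟨h1, h2⟩ := (formConverges_iff hf (fun n => (he n).symm) u).mp hφ
    obtain ⟨k, hk⟩ := cauchySeq_tendsto_of_complete h2
    exact ⟨k, mem_closedGraph_iff_seq.mpr ⟨e, h1, hk⟩⟩
  · rintro ⟨k, hk⟩
    obtain ⟨e, h1, h2⟩ := mem_closedGraph_iff_seq.mp hk
    exact ⟨fun n => ⟨i (e n), hT ▸ ⟨e n, rfl⟩⟩,
      (formConverges_iff hf (fun n => rfl) u).mpr ⟨h1, h2.cauchySeq⟩⟩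

include hc hT hf in
-- By completeness and closability, `g` along any sequence form-convergent to `u` tends to the one
-- `k` paired with `u`. The limit of the form is therefore independent of the sequences.
lemma isClosedFormValue_iff [CompleteSpace K] {u v : H} {k l : K}
    (hu : (u, k) ∈ closedGraph i g) (hv : (v, l) ∈ closedGraph i g) (c : ℂ) :
    IsClosedFormValue T u v c ↔ c = inner ℂ l k := by
  have hlim : ∀ {φ : ℕ → T.domain} {w : H} {m : K}, (w, m) ∈ closedGraph i g →
      FormConverges T φ w → ∃ e : ℕ → E, (∀ n, (φ n : H) = i (e n)) ∧
        Tendsto (fun n => g (e n)) atTop (𝓝 m) := by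
    intro φ w m hw hφ
    have : ∀ n, ∃ e, i e = (φ n : H) := fun n => by
      exact hT.le (φ n).2
    choose e he using this
    obtain ⟨h1, h2⟩ := (formConverges_iff hf (fun n => (he n).symm) w).mp hφ
    obtain ⟨k, hk⟩ := cauchySeq_tendsto_of_complete h2
    obtain rfl := closedGraph_unique hc hw (mem_closedGraph_iff_seq.mpr ⟨e, h1, hk⟩)
    exact ⟨e, fun n => (he n).symm, hk⟩
  have hval : ∀ {φ ψ : ℕ → T.domain}, FormConverges T φ u → FormConverges T ψ v →
      Tendsto (fun n => form T (φ n) (ψ n)) atTop (𝓝 (inner ℂ l k)) := by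
    intro φ ψ hφ hψ
    obtain ⟨e, he, he'⟩ := hlim hu hφ
    obtain ⟨d, hd, hd'⟩ := hlim hv hψ
    simp_rw [fun n => hf _ _ _ _ (he n) (hd n)]
    exact hd'.inner he'
  constructor
  · intro h
    -- A closed form value is a statement about all approximating sequences; it determines `c` only
    -- because such sequences exist for `u` and `v`.
    have hu' : u ∈ closedFormDomain T := by rw [closedFormDomain_eq hT hf]; exact ⟨k, hu⟩
    have hv' : v ∈ closedFormDomain T := by rw [closedFormDomain_eq hT hf]; exact ⟨l, hv⟩
    obtain ⟨φ, hφ⟩ := hu'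
    obtain ⟨ψ, hψ⟩ := hv'
    exact tendsto_nhds_unique (h φ ψ hφ hψ) (hval hφ hψ)
  · rintro rfl φ ψ hφ hψ
    exact hval hφ hψ

include hd hc hT hf in
/-- The operator associated with the closure of the form of `T` is the Friedrichs extension of
`T`. -/
theorem isFriedrichsExtension_associated [CompleteSpace K] :
    IsFriedrichsExtension T (associated i g) where
  dense := by rw [hT]; exact hd
  symmetric := by
    have hle := le_associated hd hc hT hf
    intro x y
    rw [hle.2 (y := ⟨x, hle.1 x.2⟩) rfl, hle.2 (y := ⟨y, hle.1 y.2⟩) rfl]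
    exact associated_isFormalAdjoint hd hc ⟨x, hle.1 x.2⟩ ⟨y, hle.1 y.2⟩
  semibounded := by
    refine ⟨0, fun u => ?_⟩
    have hu : (u : H) ∈ LinearMap.range i := hT ▸ u.2
    obtain ⟨φ, hφ⟩ := hu
    rw [hf φ φ u u hφ.symm hφ.symm, zero_mul]
    exact inner_self_nonneg (𝕜 := ℂ)
  graph u f := by
    rw [associated_graph hd hc, closedFormDomain_eq hT hf]
    constructor
    · rintro ⟨k, hk, h⟩
      refine ⟨⟨k, hk⟩, ?_⟩
      rintro v ⟨l, hl⟩
      exact (isClosedFormValue_iff hc hT hf hk hl _).mpr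
        (inner_eq_of_mem_closedGraph (u := (u, k)) h hl).symm
    · rintro ⟨⟨k, hk⟩, h⟩
      exact ⟨k, hk, fun φ => ((isClosedFormValue_iff hc hT hf hk (mk_mem_closedGraph φ) _).mp
        (h _ ⟨g φ, mk_mem_closedGraph φ⟩)).symm⟩

end FriedrichsExt

namespace OpenR3

variable {Ω : Opens R3}

/-! ## Calculus of test functions -/

section Calculus

lemma partialDeriv_apply (k : Fin 3) (φ : 𝓓(Ω, ℂ)) (x : R3) :
    partialDeriv k φ x = fderiv ℝ φ x (basisVec k) := by
  rw [← (φ.contDiff.differentiable (by simp) x).lineDeriv_eq_fderiv]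
  exact TestFunction.lineDerivCLM_apply_of_le (by simp)

lemma component_apply (k : Fin 3) (φ : 𝓓(Ω, C3)) (x : R3) : component k φ x = φ x k := rfl

lemma alongBasis_apply (k : Fin 3) (u : 𝓓(Ω, ℂ)) (x : R3) :
    alongBasis k u x = u x • (EuclideanSpace.single k (1 : ℂ) : C3) := rfl

lemma sum_test_apply {F ι : Type*} [NormedAddCommGroup F] [NormedSpace ℝ F]
    (s : Finset ι) (φ : ι → 𝓓(Ω, F)) (x : R3) :
    (∑ j ∈ s, φ j) x = ∑ j ∈ s, φ j x := by
  classical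
  induction s using Finset.induction_on with
  | empty => simp
  | insert j s hj ih => rw [Finset.sum_insert hj, Finset.sum_insert hj, ← ih]; rfl

lemma testDiv_apply (φ : 𝓓(Ω, C3)) (x : R3) :
    testDiv φ x = ∑ k, partialDeriv k (component k φ) x := by
  simp [testDiv, LinearMap.sum_apply]

lemma testGrad_apply (η : 𝓓(Ω, ℂ)) (k : Fin 3) (x : R3) :
    testGrad η x k = partialDeriv k η x := by
  simp only [testGrad, LinearMap.sum_apply, sum_test_apply, LinearMap.comp_apply,
    alongBasis_apply]
  simp [WithLp.ofLp_sum, Finset.sum_apply, Pi.single_apply]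

/-- The complex conjugate of a test function. -/
def conjTest (χ : 𝓓(Ω, ℂ)) : 𝓓(Ω, ℂ) :=
  TestFunction.postcompCLM (𝕜 := ℝ) (Complex.conjCLE : ℂ →L[ℝ] ℂ) χ

lemma conjTest_apply (χ : 𝓓(Ω, ℂ)) (x : R3) : conjTest χ x = starRingEnd ℂ (χ x) := rfl

lemma conjTest_conjTest (χ : 𝓓(Ω, ℂ)) : conjTest (conjTest χ) = χ := by
  ext x
  simp [conjTest_apply]

lemma partialDeriv_conjTest (k : Fin 3) (χ : 𝓓(Ω, ℂ)) :
    partialDeriv k (conjTest χ) = conjTest (partialDeriv k χ) := by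
  ext x
  rw [conjTest_apply, partialDeriv_apply, partialDeriv_apply]
  have h : HasFDerivAt (conjTest χ) ((Complex.conjCLE : ℂ →L[ℝ] ℂ) ∘L fderiv ℝ χ x) x :=
    (Complex.conjCLE : ℂ →L[ℝ] ℂ).hasFDerivAt.comp x
      (χ.contDiff.differentiable (by simp) x).hasFDerivAt
  rw [h.fderiv]
  rfl

lemma integrable_mul_test (χ η : 𝓓(Ω, ℂ)) : Integrable (fun x => χ x * η x) :=
  (χ.continuous.mul η.continuous).integrable_of_hasCompactSupport
    χ.hasCompactSupport.mul_right

lemma integral_mul_partialDeriv (k : Fin 3) (χ η : 𝓓(Ω, ℂ)) :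
    ∫ x, χ x * partialDeriv k η x = -∫ x, partialDeriv k χ x * η x := by
  have h1 := integrable_mul_test (partialDeriv k χ) η
  have h2 := integrable_mul_test χ (partialDeriv k η)
  simp only [partialDeriv_apply] at h1 h2 ⊢
  exact integral_mul_fderiv_eq_neg_fderiv_mul_of_integrable h1 h2 (integrable_mul_test χ η)
    (fun x _ => χ.contDiff.differentiable (by simp) x)
    (fun x _ => η.contDiff.differentiable (by simp) x)

/-- The gradient and minus the divergence are formally adjoint. -/
lemma integral_inner_testGrad (ψ : 𝓓(Ω, C3)) (η : 𝓓(Ω, ℂ)) :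
    ∫ x, inner ℂ (ψ x) (testGrad η x) = -∫ x, inner ℂ (testDiv ψ x) (η x) := by
  have h1 : ∀ x, inner ℂ (ψ x) (testGrad η x) =
      ∑ k, conjTest (component k ψ) x * partialDeriv k η x := fun x => by
    simp [PiLp.inner_apply, testGrad_apply, conjTest_apply, component_apply, mul_comm]
  have h2 : ∀ x, inner ℂ (testDiv ψ x) (η x) =
      ∑ k, partialDeriv k (conjTest (component k ψ)) x * η x := fun x => by
    simp [testDiv_apply, partialDeriv_conjTest, conjTest_apply, Finset.mul_sum, mul_comm]
  simp_rw [h1, h2]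
  rw [integral_finsetSum _ fun k _ => integrable_mul_test _ _,
    integral_finsetSum _ fun k _ => integrable_mul_test _ _, ← Finset.sum_neg_distrib]
  exact Finset.sum_congr rfl fun k _ => integral_mul_partialDeriv k _ η

lemma mulSmooth_apply {F : Type*} [NormedAddCommGroup F] [NormedSpace ℝ F] [NormedSpace ℂ F]
    [IsScalarTower ℝ ℂ F] (a : R3 → ℝ) (ha : ContDiffOn ℝ ∞ a Ω) (φ : 𝓓(Ω, F)) (x : R3) :
    mulSmooth a ha φ x = a x • φ x := rfl

lemma mulSmooth_mulSmooth_inv {F : Type*} [NormedAddCommGroup F] [NormedSpace ℝ F]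
    [NormedSpace ℂ F] [IsScalarTower ℝ ℂ F] {a : R3 → ℝ} (ha : ContDiffOn ℝ ∞ a Ω)
    (ha' : ContDiffOn ℝ ∞ (fun x => (a x)⁻¹) Ω) (h0 : ∀ x ∈ Ω, 0 < a x) (φ : 𝓓(Ω, F)) :
    mulSmooth a ha (mulSmooth _ ha' φ) = φ := by
  ext x
  rw [mulSmooth_apply, mulSmooth_apply]
  by_cases hx : x ∈ Ω
  · rw [smul_smul, mul_inv_cancel₀ (h0 x hx).ne', one_smul]
  · rw [image_eq_zero_of_notMem_tsupport fun hx' => hx (φ.tsupport_subset hx'), smul_zero,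
      smul_zero]

lemma mulSmooth_inv_mulSmooth {F : Type*} [NormedAddCommGroup F] [NormedSpace ℝ F]
    [NormedSpace ℂ F] [IsScalarTower ℝ ℂ F] {a : R3 → ℝ} (ha : ContDiffOn ℝ ∞ a Ω)
    (ha' : ContDiffOn ℝ ∞ (fun x => (a x)⁻¹) Ω) (h0 : ∀ x ∈ Ω, 0 < a x) (φ : 𝓓(Ω, F)) :
    mulSmooth _ ha' (mulSmooth a ha φ) = φ := by
  ext x
  rw [mulSmooth_apply, mulSmooth_apply]
  by_cases hx : x ∈ Ω
  · rw [smul_smul, inv_mul_cancel₀ (h0 x hx).ne', one_smul]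
  · rw [image_eq_zero_of_notMem_tsupport fun hx' => hx (φ.tsupport_subset hx'), smul_zero,
      smul_zero]

end Calculus

/-! ## Weighted spaces -/

section Weighted

variable {w : R3 → ℝ}

lemma aemeasurable_weight (hw : ContinuousOn w Ω) :
    AEMeasurable (fun x => ENNReal.ofReal (w x)) (volume.restrict (Ω : Set R3)) :=
  (hw.aemeasurable Ω.isOpen.measurableSet).ennreal_ofReal

/-- A positive weight leaves the null subsets of `Ω` unchanged. -/
lemma ae_weighted_iff (hw : ContinuousOn w Ω) (hpos : ∀ x ∈ Ω, 0 < w x) {p : R3 → Prop} :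
    (∀ᵐ x ∂weighted Ω w, p x) ↔ ∀ᵐ x, x ∈ Ω → p x := by
  rw [weighted, ae_withDensity_iff' (aemeasurable_weight hw),
    ae_restrict_iff' Ω.isOpen.measurableSet]
  refine eventually_congr (Eventually.of_forall fun x => forall_congr' fun hx => ?_)
  have := (ENNReal.ofReal_pos.mpr (hpos x hx)).ne'
  simp [this]

lemma integral_weighted {E : Type*} [NormedAddCommGroup E] [NormedSpace ℝ E]
    (hw : ContinuousOn w Ω) (hpos : ∀ x ∈ Ω, 0 < w x) {f : R3 → E} (hf : ∀ x ∉ Ω, f x = 0) :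
    ∫ x, f x ∂weighted Ω w = ∫ x, w x • f x := by
  rw [weighted, integral_withDensity_eq_integral_toReal_smul₀ (aemeasurable_weight hw)
    (Eventually.of_forall fun _ => ENNReal.ofReal_lt_top),
    ← setIntegral_eq_integral_of_forall_compl_eq_zero (s := (Ω : Set R3))
      (f := fun x => w x • f x) (fun x hx => by simp only [hf x hx, smul_zero])]
  refine setIntegral_congr_fun Ω.isOpen.measurableSet fun x hx => ?_
  simp only [ENNReal.toReal_ofReal (hpos x hx).le]

variable {F : Type*} [NormedAddCommGroup F]

/-- On a compact subset of `Ω` the weight has a positive minimum, so Lebesgue measure there is at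
most a multiple of the weighted measure. On a set of finite measure, `L²` is contained in `L¹`. -/
lemma locallyIntegrableOn_of_memLp_weighted (hw : ContinuousOn w Ω) (hpos : ∀ x ∈ Ω, 0 < w x)
    {u : R3 → F} (hu : MemLp u 2 (weighted Ω w)) : LocallyIntegrableOn u Ω := by
  rw [locallyIntegrableOn_iff Ω.isOpen.isLocallyClosed]
  intro K hKΩ hK
  rcases K.eq_empty_or_nonempty with rfl | hne
  · simp
  obtain ⟨x₀, hx₀, hmin⟩ := hK.exists_isMinOn hne (hw.mono hKΩ)
  have hc : 0 < w x₀ := hpos x₀ (hKΩ hx₀)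
  have hle : volume.restrict K ≤ (ENNReal.ofReal (w x₀))⁻¹ • weighted Ω w := by
    refine Measure.le_iff.mpr fun s hs => ?_
    have h1 : ENNReal.ofReal (w x₀) * volume (s ∩ K) ≤ weighted Ω w s := by
      rw [weighted, withDensity_apply _ hs, Measure.restrict_restrict hs]
      calc ENNReal.ofReal (w x₀) * volume (s ∩ K)
          = ∫⁻ _ in s ∩ K, ENNReal.ofReal (w x₀) := by rw [setLIntegral_const]
        _ ≤ ∫⁻ x in s ∩ K, ENNReal.ofReal (w x) :=
            setLIntegral_mono' (hs.inter hK.measurableSet) fun x hx =>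
              ENNReal.ofReal_le_ofReal (hmin hx.2)
        _ ≤ ∫⁻ x in s ∩ Ω, ENNReal.ofReal (w x) :=
            lintegral_mono_set (inter_subset_inter_right _ hKΩ)
    rw [Measure.restrict_apply hs, Measure.smul_apply, smul_eq_mul]
    calc volume (s ∩ K)
        = (ENNReal.ofReal (w x₀))⁻¹ * (ENNReal.ofReal (w x₀) * volume (s ∩ K)) := by
          rw [← mul_assoc, ENNReal.inv_mul_cancel (ENNReal.ofReal_pos.mpr hc).ne'
            ENNReal.ofReal_ne_top, one_mul]
      _ ≤ _ := by gcongr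
  have h2 : MemLp u 2 (volume.restrict K) :=
    (hu.smul_measure (ENNReal.inv_ne_top.mpr (ENNReal.ofReal_pos.mpr hc).ne')).mono_measure hle
  have : IsFiniteMeasure (volume.restrict K) := ⟨by
    rw [Measure.restrict_apply_univ]; exact hK.measure_lt_top⟩
  exact h2.integrable (by norm_num)

lemma locallyIntegrableOn_smul [NormedSpace ℝ F] (hw : ContinuousOn w Ω) {u : R3 → F}
    (hu : LocallyIntegrableOn u Ω) : LocallyIntegrableOn (fun x => w x • u x) Ω :=
  hu.continuousOn_smul Ω.isOpen.isLocallyClosed hw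

variable [InnerProductSpace ℂ F] [NormedSpace ℝ F] [IsScalarTower ℝ ℂ F]

lemma inner_testToL2 (hw : ContinuousOn w Ω) (hpos : ∀ x ∈ Ω, 0 < w x) (φ : 𝓓(Ω, F))
    (u : Lp F 2 (weighted Ω w)) :
    inner ℂ (testToL2 w hw φ) u = ∫ x, w x • inner ℂ (φ x) (u x) := by
  rw [L2.inner_def, ← integral_weighted hw hpos]
  · refine integral_congr_ae ?_
    filter_upwards [(memLp_weighted hw φ).coeFn_toLp] with x hx
    rw [← hx]
    rfl
  · intro x hx
    rw [image_eq_zero_of_notMem_tsupport fun hx' => hx (φ.tsupport_subset hx'), inner_zero_left]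

lemma inner_testToL2_testToL2 (hw : ContinuousOn w Ω) (hpos : ∀ x ∈ Ω, 0 < w x)
    (φ ψ : 𝓓(Ω, F)) :
    inner ℂ (testToL2 w hw φ) (testToL2 w hw ψ) = ∫ x, w x • inner ℂ (φ x) (ψ x) := by
  rw [inner_testToL2 hw hpos]
  refine integral_congr_ae ?_
  filter_upwards [(ae_weighted_iff hw hpos).mp (memLp_weighted hw ψ).coeFn_toLp] with x hx
  by_cases hxΩ : x ∈ Ω
  · rw [← hx hxΩ]
    rfl
  · simp [image_eq_zero_of_notMem_tsupport fun hx' => hxΩ (φ.tsupport_subset hx')]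

/-- The test field `h c` for a smooth function `h` supported in `Ω`. -/
def smulTest (h : R3 → ℝ) (hs : ContDiff ℝ ∞ h) (hc : HasCompactSupport h)
    (hsub : tsupport h ⊆ Ω) (c : F) : 𝓓(Ω, F) where
  toFun x := h x • c
  contDiff' := hs.smul contDiff_const
  hasCompactSupport' := hc.smul_right
  tsupport_subset' := (closure_mono (Function.support_smul_subset_left _ _)).trans hsub

/-- The test functions are dense in the weighted `L²` space. -/
theorem denseRange_testToL2 [CompleteSpace F] (hw : ContinuousOn w Ω)
    (hpos : ∀ x ∈ Ω, 0 < w x) : DenseRange (testToL2 (Ω := Ω) (F := F) w hw) := by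
  -- If `u` is orthogonal to all test functions, the locally integrable function `w u` integrates to
  -- zero against every real bump `h`. The fundamental lemma of the calculus of variations then
  -- gives `w u = 0` on `Ω`.
  have hbot : (LinearMap.range (testToL2 (Ω := Ω) (F := F) w hw))ᗮ = ⊥ := by
    rw [Submodule.eq_bot_iff]
    intro u hu
    have hint : LocallyIntegrableOn (fun x => w x • u x) Ω :=
      locallyIntegrableOn_smul hw (locallyIntegrableOn_of_memLp_weighted hw hpos (Lp.memLp u))
    have hzero : ∀ᵐ x, x ∈ (Ω : Set R3) → w x • u x = 0 := by
      refine Ω.isOpen.ae_eq_zero_of_integral_contDiff_smul_eq_zero hint ?_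
      intro h hs hc hsub
      have hi : Integrable (fun x => h x • w x • u x) :=
        TestFunction.integrable_bilin (ContinuousLinearMap.lsmul ℝ ℝ) hint
          (smulTest h hs hc hsub (1 : ℝ)) |>.congr (Eventually.of_forall fun x => by
            change (h x • (1 : ℝ)) • w x • u x = _
            simp)
      -- The vector integral of `h w u` is tested against each constant `c`, which amounts to
      -- pairing `u` with the test function `h c`.
      refine ext_inner_left ℂ fun c => ?_
      rw [← integral_inner hi, inner_zero_right]
      have h1 := hu _ ⟨smulTest h hs hc hsub c, rfl⟩
      rw [inner_testToL2 hw hpos] at h1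
      rw [← h1]
      refine integral_congr_ae (Eventually.of_forall fun x => ?_)
      change inner ℂ c (h x • w x • u x) = w x • inner ℂ (h x • c) (u x)
      have hr : ∀ (r : ℝ) (v : F), r • v = (r : ℂ) • v := fun r v => (algebraMap_smul ℂ r v).symm
      rw [hr, hr, hr, inner_smul_left, inner_smul_right, inner_smul_right, Complex.real_smul,
        Complex.conj_ofReal]
      ring
    rw [Lp.eq_zero_iff_ae_eq_zero]
    refine (ae_weighted_iff hw hpos).mpr ?_
    filter_upwards [hzero] with x hx hxΩ
    exact (smul_eq_zero.mp (hx hxΩ)).resolve_left (hpos x hxΩ).ne'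
  have h := Submodule.topologicalClosure_eq_top_iff.mpr hbot
  have h2 := Submodule.dense_iff_topologicalClosure_eq_top.mpr h
  exact h2

end Weighted

end OpenR3

namespace OpenR3

/-! ## Distributions of weighted square integrable functions as inner products -/

variable {Ω : Opens R3} {w : R3 → ℝ}

lemma distrOf_apply {u : R3 → ℂ} (hu : LocallyIntegrableOn u Ω) (χ : 𝓓(Ω, ℂ)) :
    distrOf u χ = ∫ x, χ x * u x :=
  TestFunction.integralAgainstBilinCLM_eq_integral (B := ContinuousLinearMap.mul ℂ ℂ) hu

lemma locallyIntegrableOn_component {u : R3 → C3} (hu : LocallyIntegrableOn u Ω) (k : Fin 3) :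
    LocallyIntegrableOn (fun x => u x k) Ω := by
  rw [locallyIntegrableOn_iff Ω.isOpen.isLocallyClosed] at hu ⊢
  exact fun K hK hK' =>
    (EuclideanSpace.proj (𝕜 := ℂ) k : C3 →L[ℂ] ℂ).integrable_comp (hu K hK hK')

/-- Dividing the test function by `w` cancels the weight of the inner product, and conjugating it
compensates for the conjugate-linear slot. Distributional identities thus become continuous in the
norm of the weighted space. -/
lemma distrOf_eq_inner (hw : ContinuousOn w Ω) (hpos : ∀ x ∈ Ω, 0 < w x)
    (hw' : ContDiffOn ℝ ∞ (fun x => (w x)⁻¹) Ω) (g : Lp ℂ 2 (weighted Ω w)) (χ : 𝓓(Ω, ℂ)) :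
    distrOf g χ = inner ℂ (testToL2 w hw (mulSmooth _ hw' (conjTest χ))) g := by
  rw [distrOf_apply (locallyIntegrableOn_of_memLp_weighted hw hpos (Lp.memLp g)),
    inner_testToL2 hw hpos]
  refine integral_congr_ae (Eventually.of_forall fun x => ?_)
  simp only [mulSmooth_apply, conjTest_apply, Complex.real_smul, RCLike.inner_apply, map_mul,
    Complex.conj_conj, Complex.conj_ofReal]
  by_cases hx : x ∈ Ω
  · have h0 : (w x : ℂ) ≠ 0 := Complex.ofReal_ne_zero.mpr (hpos x hx).ne'
    push_cast
    field_simp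
  · simp [image_eq_zero_of_notMem_tsupport fun hx' => hx (χ.tsupport_subset hx')]

lemma distrOf_component_eq_inner (hw : ContinuousOn w Ω) (hpos : ∀ x ∈ Ω, 0 < w x)
    (hw' : ContDiffOn ℝ ∞ (fun x => (w x)⁻¹) Ω) (f : Lp C3 2 (weighted Ω w)) (k : Fin 3)
    (χ : 𝓓(Ω, ℂ)) :
    distrOf (fun x => f x k) χ =
      inner ℂ (testToL2 w hw (mulSmooth _ hw' (alongBasis k (conjTest χ)))) f := by
  rw [distrOf_apply (locallyIntegrableOn_component
    (locallyIntegrableOn_of_memLp_weighted hw hpos (Lp.memLp f)) k), inner_testToL2 hw hpos]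
  refine integral_congr_ae (Eventually.of_forall fun x => ?_)
  have h1 : inner ℂ (mulSmooth _ hw' (alongBasis k (conjTest χ)) x) (f x) =
      ((w x)⁻¹ : ℝ) * (χ x * f x k) := by
    rw [mulSmooth_apply, alongBasis_apply, conjTest_apply, RCLike.real_smul_eq_coe_smul (K := ℂ),
      inner_smul_left, inner_smul_left, EuclideanSpace.inner_single_left]
    simp
  simp only [h1, Complex.real_smul]
  by_cases hx : x ∈ Ω
  · have h0 : (w x : ℂ) ≠ 0 := Complex.ofReal_ne_zero.mpr (hpos x hx).ne'
    push_cast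
    field_simp
  · simp [image_eq_zero_of_notMem_tsupport fun hx' => hx (χ.tsupport_subset hx')]

/-- The field `w ξ` already carries the weight of the inner product, so here the test function is
not divided by `w`. -/
lemma distrDiv_smul_eq_inner (hw : ContinuousOn w Ω) (hpos : ∀ x ∈ Ω, 0 < w x)
    (ξ : Lp C3 2 (weighted Ω w)) (χ : 𝓓(Ω, ℂ)) :
    distrDiv (fun x => w x • ξ x) χ =
      -inner ℂ (testToL2 w hw (testGrad (conjTest χ))) ξ := by
  have hint := locallyIntegrableOn_smul hw
    (locallyIntegrableOn_of_memLp_weighted hw hpos (Lp.memLp ξ))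
  have h1 : ∀ k, distrDeriv k (distrOf fun x => (w x • ξ x) k) χ =
      -∫ x, partialDeriv k χ x * (w x • ξ x) k := fun k => by
    rw [← distrOf_apply (locallyIntegrableOn_component hint k)]
    rfl
  have h2 : ∀ x, w x • inner ℂ (testGrad (conjTest χ) x) (ξ x) =
      ∑ k, partialDeriv k χ x * (w x • ξ x) k := fun x => by
    simp only [PiLp.inner_apply, testGrad_apply, partialDeriv_conjTest, conjTest_apply,
      RCLike.inner_apply, Complex.conj_conj, Finset.smul_sum, PiLp.smul_apply, Complex.real_smul]
    exact Finset.sum_congr rfl fun k _ => by ring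
  rw [inner_testToL2 hw hpos, distrDiv, LinearMap.sum_apply]
  simp_rw [h1, h2]
  have h3 : ∀ k, Integrable fun x => partialDeriv k χ x * (w x • ξ x) k := fun k =>
    TestFunction.integrable_bilin (ContinuousLinearMap.mul ℂ ℂ)
      (locallyIntegrableOn_component hint k) _
  rw [integral_finsetSum _ fun k _ => h3 k, Finset.sum_neg_distrib]

/-- Each weight is absorbed into the test function on its own side, `w` into `ψ` and `v` into `η`.
What remains is the unweighted adjointness of gradient and minus divergence. -/
lemma inner_testToL2_testGrad {v : R3 → ℝ} (hw : ContDiffOn ℝ ∞ w Ω) (hpos : ∀ x ∈ Ω, 0 < w x)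
    (hv : ContDiffOn ℝ ∞ v Ω) (hvpos : ∀ x ∈ Ω, 0 < v x) (ψ : 𝓓(Ω, C3)) (η : 𝓓(Ω, ℂ)) :
    inner ℂ (testToL2 w hw.continuousOn ψ)
        (testToL2 w hw.continuousOn (testGrad (mulSmooth v hv η))) =
      -inner ℂ (testToL2 v hv.continuousOn (testDiv (mulSmooth w hw ψ)))
        (testToL2 v hv.continuousOn η) := by
  rw [inner_testToL2_testToL2 _ hpos, inner_testToL2_testToL2 _ hvpos]
  have h := integral_inner_testGrad (mulSmooth w hw ψ) (mulSmooth v hv η)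
  simp only [mulSmooth_apply, RCLike.real_smul_eq_coe_smul (K := ℂ), inner_smul_left,
    inner_smul_right] at h ⊢
  simpa using h

end OpenR3

/-! ### Green's formula, `H^div_0` and the distributional operator for the atmosphere -/

namespace Atmosphere

open OpenR3 FriedrichsExt

variable (a : Atmosphere)

lemma stiffness_pos {x : R3} (hx : x ∈ a.region) : 0 < a.stiffness x := by
  rw [a.stiffness_eq hx]
  exact mul_pos (mul_pos a.A_pos (one_pos.trans a.one_lt_γ))
    (Real.rpow_pos_of_pos (a.density_pos hx) _)

lemma density_inv_smooth : ContDiffOn ℝ ∞ (fun x => (a.density x)⁻¹) a.region :=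
  a.density_smooth.inv fun _ hx => (a.density_pos hx).ne'

lemma stiffness_inv_smooth : ContDiffOn ℝ ∞ (fun x => (a.stiffness x)⁻¹) a.region :=
  a.stiffness_smooth.inv fun _ hx => (a.stiffness_pos hx).ne'

/-- `∇·(ρ φ)` as an element of `K`. -/
def testGToK : 𝓓(a.region, C3) →ₗ[ℂ] a.K := a.testToK ∘ₗ a.testG

lemma denseRange_testToH : DenseRange a.testToH :=
  denseRange_testToL2 _ fun _ hx => a.density_pos hx

lemma denseRange_testToK : DenseRange a.testToK :=
  denseRange_testToL2 _ fun _ hx => a.stiffness_pos hx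

lemma distrG_apply (ξ : a.H) (χ : 𝓓(a.region, ℂ)) :
    a.distrG ξ χ = -inner ℂ (a.testToH (testGrad (conjTest χ))) ξ :=
  distrDiv_smul_eq_inner _ (fun _ hx => a.density_pos hx) ξ χ

lemma distrOf_K_apply (g : a.K) (χ : 𝓓(a.region, ℂ)) : distrOf g χ =
    inner ℂ (a.testToK (mulSmooth _ a.stiffness_inv_smooth (conjTest χ))) g :=
  distrOf_eq_inner _ (fun _ hx => a.stiffness_pos hx) a.stiffness_inv_smooth g χ

lemma distrOf_H_apply (f : a.H) (k : Fin 3) (χ : 𝓓(a.region, ℂ)) :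
    distrOf (fun x => f x k) χ =
      inner ℂ (a.testToH (mulSmooth _ a.density_inv_smooth (alongBasis k (conjTest χ)))) f :=
  distrOf_component_eq_inner _ (fun _ hx => a.density_pos hx) a.density_inv_smooth f k χ

lemma inner_testToH_testGrad (ψ : 𝓓(a.region, C3)) (η : 𝓓(a.region, ℂ)) :
    inner ℂ (a.testToH ψ) (a.testToH (testGrad (mulSmooth _ a.stiffness_smooth η))) =
      -inner ℂ (a.testGToK ψ) (a.testToK η) :=
  inner_testToL2_testGrad a.density_smooth (fun _ hx => a.density_pos hx) a.stiffness_smooth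
    (fun _ hx => a.stiffness_pos hx) ψ η

/-- Green's formula for `L`. -/
lemma form_minimalL (φ ψ : 𝓓(a.region, C3)) (u v : a.minimalL.domain)
    (hu : (u : a.H) = a.testToH φ) (hv : (v : a.H) = a.testToH ψ) :
    form a.minimalL u v = inner ℂ (a.testGToK ψ) (a.testGToK φ) := by
  obtain rfl : u = ⟨a.testToH φ, φ, rfl⟩ := Subtype.ext hu
  rw [form, minimalL_apply, hv]
  have h : a.testL φ = -testGrad (mulSmooth _ a.stiffness_smooth (a.testG φ)) := by
    simp [testL]
  rw [h, map_neg, inner_neg_right, inner_testToH_testGrad, neg_neg]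
  rfl

/-- This is the adjointness formula with `η` the conjugate of `χ` divided by `dϒ/dρ`, so that the
weight cancels. -/
lemma isHdiv_test (φ : 𝓓(a.region, C3)) : a.IsHdiv (a.testToH φ) (a.testGToK φ) := by
  refine LinearMap.ext fun χ => ?_
  have h := a.inner_testToH_testGrad φ (mulSmooth _ a.stiffness_inv_smooth (conjTest χ))
  rw [mulSmooth_mulSmooth_inv _ _ fun _ hx => a.stiffness_pos hx] at h
  rw [distrG_apply, distrOf_K_apply, ← inner_conj_symm, h, map_neg, neg_neg, inner_conj_symm]

/-- For a fixed test function both sides are inner products with fixed vectors, so the identity for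
test fields survives the limit. -/
lemma isHdiv_of_mem_closedGraph {ξ : a.H} {g : a.K}
    (h : (ξ, g) ∈ closedGraph a.testToH a.testGToK) : a.IsHdiv ξ g := by
  obtain ⟨e, h1, h2⟩ := mem_closedGraph_iff_seq.mp h
  refine LinearMap.ext fun χ => ?_
  rw [distrG_apply, distrOf_K_apply]
  refine tendsto_nhds_unique (tendsto_const_nhds.inner h1).neg ?_
  refine (tendsto_const_nhds.inner h2).congr fun n => ?_
  rw [← distrG_apply, ← distrOf_K_apply, ← a.isHdiv_test (e n)]

/-- This is closability: `g` is the distributional divergence of `0`, hence orthogonal to the test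
functions, which are dense in `K`. -/
lemma eq_zero_of_mem_closedGraph (g : a.K)
    (h : (0, g) ∈ closedGraph a.testToH a.testGToK) : g = 0 := by
  refine a.denseRange_testToK.eq_zero_of_inner_right ℂ fun η => ?_
  -- The test function is chosen so that its conjugation and weight undo those in `distrOf_K_apply`,
  -- leaving the pairing with `η`.
  have h1 := LinearMap.congr_fun (a.isHdiv_of_mem_closedGraph h)
    (conjTest (mulSmooth _ a.stiffness_smooth η))
  rw [distrG_apply, distrOf_K_apply, conjTest_conjTest,
    mulSmooth_inv_mulSmooth _ _ fun _ hx => a.stiffness_pos hx, inner_zero_right, neg_zero] at h1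
  exact h1.symm

/-- The `H^div` norm of a pair and the maximum norm of `H × K` are equivalent, and the condition
`∇·(ρ ξ) = g` is automatic on the closed graph. -/
lemma mem_HdivZero {ξ : a.H} :
    ξ ∈ a.HdivZero ↔ ∃ g, (ξ, g) ∈ closedGraph a.testToH a.testGToK := by
  refine exists_congr fun g => ?_
  constructor
  · rintro ⟨-, h⟩
    rw [closedGraph, ← SetLike.mem_coe, Submodule.topologicalClosure_coe, Metric.mem_closure_iff]
    intro ε hε
    obtain ⟨φ, hφ⟩ := h (ε ^ 2) (by positivity)
    refine ⟨_, ⟨φ, rfl⟩, ?_⟩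
    rw [Prod.dist_eq, max_lt_iff, dist_eq_norm, dist_eq_norm]
    exact ⟨lt_of_pow_lt_pow_left₀ 2 hε.le ((le_add_of_nonneg_right (sq_nonneg _)).trans_lt hφ),
      lt_of_pow_lt_pow_left₀ 2 hε.le ((le_add_of_nonneg_left (sq_nonneg _)).trans_lt hφ)⟩
  · intro h
    refine ⟨a.isHdiv_of_mem_closedGraph h, fun ε hε => ?_⟩
    obtain ⟨e, h1, h2⟩ := mem_closedGraph_iff_seq.mp h
    have h3 := ((tendsto_const_nhds (x := ξ)).sub h1).norm.pow 2
    have h4 := ((tendsto_const_nhds (x := g)).sub h2).norm.pow 2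
    have h5 := h3.add h4
    simp only [sub_self, norm_zero, ne_eq, OfNat.ofNat_ne_zero, not_false_eq_true, zero_pow,
      add_zero] at h5
    obtain ⟨n, hn⟩ := (h5.eventually (gt_mem_nhds hε)).exists
    exact ⟨e n, hn⟩

/-- The factor `ρ⁻¹` cancels the density inside the divergence. Testing with these fields isolates
the `j`-th component of `L ξ`. -/
lemma testG_alongBasis (j : Fin 3) (χ : 𝓓(a.region, ℂ)) :
    a.testG (mulSmooth _ a.density_inv_smooth (alongBasis j χ)) = partialDeriv j χ := by
  have h0 : ∀ k, component k (alongBasis j χ) = if k = j then χ else 0 := by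
    intro k
    ext x
    rw [component_apply, alongBasis_apply]
    by_cases h : k = j <;> simp [h]
  have h1 : a.testG (mulSmooth _ a.density_inv_smooth (alongBasis j χ)) =
      testDiv (alongBasis j χ) := by
    rw [testG, LinearMap.comp_apply, mulSmooth_mulSmooth_inv _ _ fun _ hx => a.density_pos hx]
  rw [h1, testDiv, LinearMap.sum_apply, Finset.sum_eq_single j]
  · simp [h0]
  · intro k _ hk
    simp [h0, hk]
  · simp

lemma sum_alongBasis_component (ψ : 𝓓(a.region, C3)) :
    ∑ j, alongBasis j (component j ψ) = ψ := by
  ext x k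
  rw [sum_test_apply]
  simp [alongBasis_apply, component_apply, WithLp.ofLp_sum, Finset.sum_apply, Pi.single_apply]

/-- The distributional equation is the weak equation restricted to the fields `ρ⁻¹ χ e_j`. These
span all test fields, so the two are equivalent. -/
lemma isDistrL_iff {ξ f : a.H} {g : a.K} (h : a.IsHdiv ξ g) :
    a.IsDistrL ξ f ↔ ∀ ψ, inner ℂ (a.testGToK ψ) g = inner ℂ (a.testToH ψ) f := by
  have h1 : ∀ j χ, a.distrL ξ j χ = inner ℂ
      (a.testGToK (mulSmooth _ a.density_inv_smooth (alongBasis j (conjTest χ)))) g := by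
    intro j χ
    have h2 : a.distrL ξ j χ = a.distrG ξ (mulSmooth _ a.stiffness_smooth (partialDeriv j χ)) := by
      simp [distrL, distrDeriv, distrMul]
    have h3 : conjTest (mulSmooth _ a.stiffness_smooth (partialDeriv j χ)) =
        mulSmooth _ a.stiffness_smooth (partialDeriv j (conjTest χ)) := by
      ext x
      simp [conjTest_apply, mulSmooth_apply, partialDeriv_conjTest]
    rw [h2, h, distrOf_K_apply, h3, mulSmooth_inv_mulSmooth _ _ fun _ hx => a.stiffness_pos hx,
      testGToK, LinearMap.comp_apply, testG_alongBasis]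
  constructor
  · intro hL ψ
    have h4 : ∀ j χ, inner ℂ
        (a.testGToK (mulSmooth _ a.density_inv_smooth (alongBasis j χ))) g =
        inner ℂ (a.testToH (mulSmooth _ a.density_inv_smooth (alongBasis j χ))) f := by
      intro j χ
      have := LinearMap.congr_fun (hL j) (conjTest χ)
      rwa [h1, distrOf_H_apply, conjTest_conjTest] at this
    -- The field `ρ ψ` is split into its components and divided by `ρ` again.
    have h5 : ψ = ∑ j, mulSmooth _ a.density_inv_smooth
        (alongBasis j (component j (mulSmooth _ a.density_smooth ψ))) := by
      rw [← map_sum, sum_alongBasis_component,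
        mulSmooth_inv_mulSmooth _ _ fun _ hx => a.density_pos hx]
    rw [h5, map_sum, map_sum, sum_inner, sum_inner]
    exact Finset.sum_congr rfl fun j _ => h4 j _
  · intro hψ j
    refine LinearMap.ext fun χ => ?_
    rw [h1, distrOf_H_apply, hψ]

lemma mem_graph_associated {ξ f : a.H} :
    (ξ, f) ∈ (associated a.testToH a.testGToK).graph ↔ ξ ∈ a.HdivZero ∧ a.IsDistrL ξ f := by
  rw [associated_graph a.denseRange_testToH a.eq_zero_of_mem_closedGraph, mem_associatedGraph,
    mem_HdivZero]
  constructor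
  · rintro ⟨g, hg, h⟩
    exact ⟨⟨g, hg⟩, (a.isDistrL_iff (a.isHdiv_of_mem_closedGraph hg)).mpr h⟩
  · rintro ⟨⟨g, hg⟩, h⟩
    exact ⟨g, hg, (a.isDistrL_iff (a.isHdiv_of_mem_closedGraph hg)).mp h⟩

end Atmosphere

end

theorem theorem3 (a : Atmosphere) :
    ∃ L : a.H →ₗ.[ℂ] a.H,
      FriedrichsExt.IsFriedrichsExtension a.minimalL L ∧
      a.minimalL ≤ L ∧
      IsSelfAdjoint L ∧
      (∀ ξ : L.domain, 0 ≤ (inner ℂ (L ξ) (ξ : a.H)).re) ∧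
      (L.domain : Set a.H) = {ξ | ξ ∈ a.HdivZero ∧ ∃ f : a.H, a.IsDistrL ξ f} ∧
      ∀ ξ : L.domain, a.IsDistrL ξ (L ξ) := by
  have hd := a.denseRange_testToH
  have hc := a.eq_zero_of_mem_closedGraph
  refine ⟨FriedrichsExt.associated a.testToH a.testGToK,
    FriedrichsExt.isFriedrichsExtension_associated hd hc rfl a.form_minimalL,
    FriedrichsExt.le_associated hd hc rfl a.form_minimalL,
    FriedrichsExt.associated_isSelfAdjoint hd hc rfl a.form_minimalL,
    FriedrichsExt.associated_nonneg hd hc, ?_, fun ξ =>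
      (a.mem_graph_associated.mp (LinearPMap.mem_graph _ ξ)).2⟩
  ext ξ
  rw [SetLike.mem_coe, LinearPMap.mem_domain_iff]
  simp only [a.mem_graph_associated, exists_and_left, mem_ofPred_eq]
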